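/- **Lemma (FLDR invariant).** *Tables.* For every integer $N\ge 1$ let positive integers $a_1,\dots,a_N$ be given (they may depend on $N$). Put $m=\sum_{i=1}^N a_i$, $k=\lceil\log_2 m\rceil$, $a_{N+1}=2^k-m$. For $0\le j\le k$ and $1\le i\le N+1$ say that row $j$ has a leaf $i$ if the bit of weight $2^{k-j}$ of $a_i$ is $1$. Let $h[j]$ be the number of leaves in row $j$ (with $h[j]=0$ for $j>k$) and $b(c)=2^c-\sum_{j=0}^c h[j]\,2^{c-j}$. The labels of the leaves of row $j$ are written, in increasing order of label and from right to left, to the positions $b(j)+h[j]-1,\,b(j)+h[j]-2,\dots,b(j)$ of row $j$ of a matrix $H$: $H[d,j]$ is the label at position $d$ of row $j$, and $H[d,j]=0$ at all other positions. (One has $b(0)+h[0]-1=0$ and $b(j)+h[j]-1=2b(j-1)-1$ for $j\ge1$.) *Program.* States assign integers to the variables $d,c,n$. The FLDR is the loop $\mathtt{while}\,(d<b(c))\,\{C\}$ with body $$C:\quad c:=c+1;\ \{d:=2d\}\,[\tfrac12]\,\{d:=2d+1\};\ \mathtt{if}\,(H[d,c]=n+1)\,\{c:=0;\ d:=0\},$$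 where $b,h,H$ are the tables for $N=n$. Its initial distributions are $\mathcal M=\{\delta_{d\mapsto0,\,c\mapsto0,\,n\mapsto N}\mid N>0\}$. $[\![C]\!]$ denotes the standard denotational semantics of $C$ on sub-distributions over states, $B$ the loop guard, and $[B]\mu$ the restriction of $\mu$ to the states that satisfy $B$. *Notation.* For the tables of $N$ let $t(c)=1$ if $H[b(c),c]=N+1$ and $t(c)=0$ otherwise, and let $$p(i)=\sum_{d,c:\,H[d,c]=i}2^{-c},\qquad \bar p(i)=p(i)\Big(1+\sum_{j\ge1}p(N+1)^j\Big),$$ $$p(i,j)=\sum_{d,c:\,H[d,c]=i,\ c>j}2^{-(c-j)},\qquad \bar p(i,j)=p(i,j)+p(N+1,j)\,\bar p(i).$$ *Invariant.* Let $\mathcal I$ be the set of all probability distributions $\mu$ on states for which there is an integer $N>0$ such that: (a) $\Pr_\mu(n=N)=1$; (b) $\Pr_\mu(0\le d\le 2N-1)=1$; (c) $\Pr_\mu(0\le c\le k)=1$; (d) for all $1\le i\le N$: $\displaystyle\sum_{\sigma:\,H[\sigma(d),\sigma(c)]=i}\mu(\sigma)+\sum_{j=0}^{k-1}\mu(d\mapsto0,c\mapsto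 j,n\mapsto N)\,\bar p(i,j)\le\bar p(i)$; (e) $\mu(\sigma)=\mu(\sigma')$ for all states $\sigma,\sigma'$ with $n=N$, the same value of $c$, and $0\le d\le b(c)-1$ (the inner nodes of a row); (f) $\mu(\sigma)=\mu(\sigma')$ for all states $\sigma,\sigma'$ with $n=N$, the same value of $c$, and $b(c)+t(c)\le d\le b(c)+h[c]-1$ (the leaves of a row other than $N+1$). *Claim.* $\mathcal I$ is an inductive distributional invariant for the FLDR and $\mathcal M$. That is, every distribution reachable from $\mathcal M$ lies in $\mathcal I$ (the set of reachable distributions is the least set that contains $\mathcal M$ and is closed under $\mu\mapsto[\![C]\!]([B]\mu)+[\neg B]\mu$), and $[\![C]\!]([B]\mu)+[\neg B]\mu\in\mathcal I$ for every $\mu\in\mathcal I$. -/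

import Mathlib

open scoped ENNReal

noncomputable section

/-! ### Probabilistic programs -/

/-- Program states: integer valuations of the program variables. -/
abbrev PState (V : Type) : Type := V → ℤ

/-- Syntax of probabilistic programs: skip, assignment, coin flip, sequential composition,
conditional choice, loop. Expressions and guards are semantic objects. -/
inductive Prog (V : Type) : Type where
  | skip : Prog V
  | assign (x : V) (E : PState V → ℤ) : Prog V
  | choice (p : unitInterval) (C₁ C₂ : Prog V) : Prog V
  | seq (C₁ C₂ : Prog V) : Prog V
  | ite (B : PState V → Prop) (C₁ C₂ : Prog V) : Prog V
  | loop (B : PState V → Prop) (C : Prog V) : Prog V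

/-- `if (B) {C}`, with `skip` in the other branch. -/
def Prog.ifThen {V : Type} (B : PState V → Prop) (C : Prog V) : Prog V :=
  Prog.ite B C Prog.skip

/-! ### Sub-distributions -/

/-- Weight functions; the (sub-)distributions are singled out by `subDists` and `dists`.
The values of a sub-distribution automatically lie in `[0,1]`. -/
abbrev Weight (S : Type) : Type := S → ℝ≥0∞

/-- Sub-distributions: mass at most `1`. -/
def subDists (S : Type) : Set (Weight S) := {μ | ∑' s, μ s ≤ 1}

/-- Proper distributions: mass exactly `1`. -/
def dists (S : Type) : Set (Weight S) := {μ | ∑' s, μ s = 1}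

/-- The Dirac distribution. -/
def diracDist {S : Type} (s : S) : Weight S := Set.indicator {s} 1

/-- The probability that `B` is satisfied in `μ`. -/
def prSat {S : Type} (μ : Weight S) (B : S → Prop) : ℝ≥0∞ := ∑' s : {s : S // B s}, μ s

/-- The filtered sub-distribution `[B] · μ`. -/
def filtered {S : Type} (B : S → Prop) (μ : Weight S) : Weight S := Set.indicator {s | B s} μ

/-! ### Denotational semantics -/

/-- The functional `Φ(f) = λ η. [¬B] · η + f (F ([B] · η))` of a loop with guard `B` whose body
has the semantics `F`. -/
def loopFunctional {S : Type} (B : S → Prop) (F : Weight S → Weight S) :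
    (Weight S → Weight S) →o (Weight S → Weight S) where
  toFun f := fun η => filtered (fun s => ¬ B s) η + f (F (filtered B η))
  monotone' := fun _ _ hfg η => add_le_add le_rfl (hfg (F (filtered B η)))

/-- The denotational semantics: programs as transformers of sub-distributions. -/
def Prog.den {V : Type} [DecidableEq V] :
    Prog V → Weight (PState V) → Weight (PState V)
  | .skip => fun μ => μ
  | .assign x E => fun μ σ =>
      ∑' σ' : {σ' : PState V // Function.update σ' x (E σ') = σ}, μ σ'
  | .choice p C₁ C₂ => fun μ =>
      C₁.den (fun σ => ENNReal.ofReal (p : ℝ) * μ σ) +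
        C₂.den (fun σ => ENNReal.ofReal (1 - (p : ℝ)) * μ σ)
  | .seq C₁ C₂ => fun μ => C₂.den (C₁.den μ)
  | .ite B C₁ C₂ => fun μ => C₁.den (filtered B μ) + C₂.den (filtered (fun σ => ¬ B σ) μ)
  | .loop B C => OrderHom.lfp (loopFunctional B C.den)

/-- The distributional strongest postcondition: the image under the denotational semantics. -/
def Prog.post {V : Type} [DecidableEq V] (C : Prog V) (M : Set (Weight (PState V))) :
    Set (Weight (PState V)) := C.den '' M

/-- The distributions reachable in the loop `while (B) {C}` from `M`: the least fixed point of
`X ↦ M ∪ post (if (B) {C}) X`. -/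
def reach {V : Type} [DecidableEq V] (B : PState V → Prop) (C : Prog V)
    (M : Set (Weight (PState V))) : Set (Weight (PState V)) :=
  OrderHom.lfp
    (⟨fun X => M ∪ (Prog.ifThen B C).post X,
      fun _ _ h => Set.union_subset_union_right M (Set.image_mono h)⟩ :
      Set (Weight (PState V)) →o Set (Weight (PState V)))

/-- `I` is a distributional invariant of the loop `P` and the initial distributions `M`. -/
def IsDistInvariant {V : Type} [DecidableEq V] (P : Prog V)
    (M I : Set (Weight (PState V))) : Prop :=
  ∃ B C, P = Prog.loop B C ∧ M ⊆ subDists (PState V) ∧ I ⊆ subDists (PState V) ∧ reach B C M ⊆ I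

/-- `I` is inductive for the loop `P`: it is preserved by one guarded iteration. -/
def IsInductive {V : Type} [DecidableEq V] (P : Prog V) (I : Set (Weight (PState V))) : Prop :=
  ∃ B C, P = Prog.loop B C ∧
    ∀ μ ∈ I, C.den (filtered B μ) + filtered (fun σ => ¬ B σ) μ ∈ I

/-! ### Preprocessing of the Fast Loaded Dice Roller

The inputs are `a 1, …, a n` (the other values of `a` are not used). -/

namespace FLDR

/-- `m = a₁ + … + aₙ`. -/
def mass (n : ℕ) (a : ℕ → ℕ) : ℕ := ∑ i ∈ Finset.Icc 1 n, a i

/-- `k = ⌈log₂ m⌉`. -/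
def depth (n : ℕ) (a : ℕ → ℕ) : ℕ := Nat.clog 2 (mass n a)

/-- The weights of the extended die: `a₁, …, aₙ` and `aₙ₊₁ = 2ᵏ - m` (here `m ≤ 2ᵏ`). -/
def side (n : ℕ) (a : ℕ → ℕ) (i : ℕ) : ℕ :=
  if i = n + 1 then 2 ^ depth n a - mass n a else a i

/-- Row `j` has a leaf labelled `i`: `j ≤ k` and the `j`-th binary digit after the point of
`aᵢ / 2ᵏ` (for `j = 0`: the digit before the point) is `1`. -/
def hasLeaf (n : ℕ) (a : ℕ → ℕ) (j i : ℕ) : Bool :=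
  decide (j ≤ depth n a) && (side n a i).testBit (depth n a - j)

/-- How many of the sides `1, …, r` have a leaf in row `j`. -/
def leafCount (n : ℕ) (a : ℕ → ℕ) (j r : ℕ) : ℕ :=
  ((Finset.Icc 1 r).filter fun i => hasLeaf n a j i).card

/-- The array `h`: the number of leaves in row `j`. -/
def h (n : ℕ) (a : ℕ → ℕ) (j : ℕ) : ℕ := leafCount n a j (n + 1)

/-- `2ᶜ - ∑_{j ≤ c} h[j] · 2ᶜ⁻ʲ`: the number of inner nodes in row `c`, so also the position of
the first leaf of that row. -/
def bound (n : ℕ) (a : ℕ → ℕ) (c : ℕ) : ℤ :=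
  2 ^ c - ∑ j ∈ Finset.range (c + 1), (h n a j : ℤ) * 2 ^ (c - j)

/-- The last position of row `j`; row `0` is the root alone, and every later row consists of the
children of the inner nodes of the row above it. -/
def lastPos (n : ℕ) (a : ℕ → ℕ) : ℕ → ℤ
  | 0 => 0
  | j + 1 => 2 * bound n a j - 1

/-- Row `j` of the matrix `H` after the iterations `i = 1, …, r` of the inner preprocessing loop:
each label that has a leaf in row `j` is written to the rightmost position that is still free. -/
def rowAfter (n : ℕ) (a : ℕ → ℕ) (j : ℕ) : ℕ → ℤ → ℕ
  | 0 => fun _ => 0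
  | i + 1 =>
      if hasLeaf n a j (i + 1) then
        Function.update (rowAfter n a j i) (lastPos n a j - leafCount n a j i) (i + 1)
      else rowAfter n a j i

/-- The matrix `H[d, c]`: the label of the `d`-th node of row `c` if that is a leaf, else `0`. -/
def H (n : ℕ) (a : ℕ → ℕ) (d : ℤ) (c : ℕ) : ℕ := rowAfter n a c (n + 1) d

/-! ### The program -/

/-- The program variables. -/
inductive Var : Type where
  | d | c | n
  deriving DecidableEq

/-- The program state `d ↦ x, c ↦ y, n ↦ z`. -/
def state (x y z : ℤ) : PState Var
  | .d => x
  | .c => y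
  | .n => z

/-- The fair coin. -/
def half : unitInterval := ⟨1 / 2, by norm_num, by norm_num⟩

/-- The loop guard `d < bound(c)`. The tables are those of the inputs `a N 1, …, a N N`, where `N`
is the value of the variable `n`, which the program never changes. No negative values of `c` or
`n` occur, so what `Int.toNat` makes of them is immaterial. -/
def guard (a : ℕ → ℕ → ℕ) (σ : PState Var) : Prop :=
  σ .d < bound (σ .n).toNat (a (σ .n).toNat) (σ .c).toNat

/-- The loop body:
`c := c + 1; {d := 2d} [1/2] {d := 2d + 1}; if (H[d, c] = n + 1) {c := 0; d := 0}`. -/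
def body (a : ℕ → ℕ → ℕ) : Prog Var :=
  .seq (.assign .c fun σ => σ .c + 1)
    (.seq
      (.choice half (.assign .d fun σ => 2 * σ .d) (.assign .d fun σ => 2 * σ .d + 1))
      (.ifThen
        (fun σ => (H (σ .n).toNat (a (σ .n).toNat) (σ .d) (σ .c).toNat : ℤ) = σ .n + 1)
        (.seq (.assign .c fun _ => 0) (.assign .d fun _ => 0))))

/-- The program, for a choice of inputs `a N 1, …, a N N` for every number of sides `N`. -/
def prog (a : ℕ → ℕ → ℕ) : Prog Var := .loop (guard a) (body a)

/-- The initial distributions: the Dirac distributions at `d ↦ 0, c ↦ 0, n ↦ N` with `N > 0`. -/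
def initial : Set (Weight (PState Var)) := {μ | ∃ N : ℕ, 0 < N ∧ μ = diracDist (state 0 0 N)}

/-! ### The invariant -/

/-- `1` if the first leaf of row `c` carries the additional label `n + 1`, else `0`. -/
def isThere (n : ℕ) (a : ℕ → ℕ) (c : ℕ) : ℤ := if H n a (bound n a c) c = n + 1 then 1 else 0

/-- The probability to draw `i` without re-rolls. -/
def prob (n : ℕ) (a : ℕ → ℕ) (i : ℕ) : ℝ≥0∞ :=
  ∑' q : {q : ℤ × ℕ // H n a q.1 q.2 = i}, (2⁻¹ : ℝ≥0∞) ^ q.1.2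

/-- The probability to draw `i` with re-rolls when `n + 1` is rolled. -/
def probRe (n : ℕ) (a : ℕ → ℕ) (i : ℕ) : ℝ≥0∞ :=
  prob n a i * (1 + ∑' j : ℕ, prob n a (n + 1) ^ (j + 1))

/-- The weight of `i` below row `j`, without re-rolls. -/
def probFrom (n : ℕ) (a : ℕ → ℕ) (i j : ℕ) : ℝ≥0∞ :=
  ∑' q : {q : ℤ × ℕ // H n a q.1 q.2 = i ∧ j < q.2}, (2⁻¹ : ℝ≥0∞) ^ (q.1.2 - j)

/-- The weight of `i` below row `j`, with re-rolls. -/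
def probReFrom (n : ℕ) (a : ℕ → ℕ) (i j : ℕ) : ℝ≥0∞ :=
  probFrom n a i j + probFrom n a (n + 1) j * probRe n a i

/-- The six conditions for a distribution `μ` and the number of sides `N` with inputs
`a 1, …, a N`. -/
structure Conditions (N : ℕ) (a : ℕ → ℕ) (μ : Weight (PState Var)) : Prop where
  n_fixed : prSat μ (fun σ => σ .n = N) = 1
  d_bounds : prSat μ (fun σ => 0 ≤ σ .d ∧ σ .d ≤ 2 * N - 1) = 1
  c_bounds : prSat μ (fun σ => 0 ≤ σ .c ∧ σ .c ≤ depth N a) = 1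
  output_le : ∀ i : ℕ, 1 ≤ i → i ≤ N →
    prSat μ (fun σ => H N a (σ .d) (σ .c).toNat = i) +
      ∑ j ∈ Finset.range (depth N a), μ (state 0 j N) * probReFrom N a i j ≤ probRe N a i
  inner_uniform : ∀ σ σ' : PState Var,
    (σ .n = N ∧ 0 ≤ σ .d ∧ σ .d ≤ bound N a (σ .c).toNat - 1) →
    (σ' .n = N ∧ 0 ≤ σ' .d ∧ σ' .d ≤ bound N a (σ' .c).toNat - 1) →
    σ .c = σ' .c → μ σ = μ σ'
  leaf_uniform : ∀ σ σ' : PState Var,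
    (σ .n = N ∧ bound N a (σ .c).toNat + isThere N a (σ .c).toNat ≤ σ .d ∧
      σ .d ≤ bound N a (σ .c).toNat + h N a (σ .c).toNat - 1) →
    (σ' .n = N ∧ bound N a (σ' .c).toNat + isThere N a (σ' .c).toNat ≤ σ' .d ∧
      σ' .d ≤ bound N a (σ' .c).toNat + h N a (σ' .c).toNat - 1) →
    σ .c = σ' .c → μ σ = μ σ'

/-- The invariant. -/
def invariant (a : ℕ → ℕ → ℕ) : Set (Weight (PState Var)) :=
  {μ | μ ∈ dists (PState Var) ∧ ∃ N : ℕ, 0 < N ∧ Conditions N (a N) μ}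

end FLDR

end

/-!
A state of the loop is a node of the tree whose row `c` consists of the inner nodes
`0, …, b(c) - 1` followed by the leaves `b(c), …, b(c) + h[c] - 1`; the nodes of row `c + 1` are the
children of the inner nodes of row `c`. The bound `b(c)`, scaled by `2 ^ (k - c)`, is the sum of the
`n + 1` remainders `aᵢ mod 2 ^ (k - c)` (`two_pow_mul_bound`), hence `0 ≤ b(c) ≤ n`, and `b(c) = 0`
from row `k` on. This keeps `d` and `c` within their bounds.

The semantics of the loop body is used in dual form only: the expected value of `g` after the body
is the expected value before it of the mean of `g` over the two outcomes of the coin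
(`expect_body`). Every node of row `j + 1` other than the leaf `n + 1` has just one parent, so it
receives half the weight of an inner node of row `j` (`UniformRows.body_apply_state`). As the inner
nodes of a row have equal weight, so have those of the next row, and also its leaves other than
`n + 1`.

The left-hand side of the output condition for `i` is the expected value of a `potential`: `1` on
the leaves `i`, and `p̄(i, j)` at the node `0` of row `j`, which stands for all inner nodes of the
row. With equal weights on the inner nodes, an iteration does not increase it
(`sum_potential_step_le`): the children of the inner nodes of row `j` contribute half of
`[row j + 1 has a leaf i] + [row j + 1 has a leaf n + 1] * p̄(i) + p̄(i, j + 1)`, which is `p̄(i, j)`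
(`probReFrom_succ`); here `p̄(i)` bounds the potential of the root, to which a re-roll returns
(`potential_root_le`). The same bound settles the initial distributions.
-/

namespace FLDR

/-! ### The rows of the tree -/

lemma mod_two_pow_succ (x s : ℕ) :
    x % 2 ^ (s + 1) = x % 2 ^ s + 2 ^ s * (x.testBit s).toNat := by
  rw [Nat.mod_pow_succ, Nat.testBit_eq_decide_div_mod_eq]
  rcases Nat.mod_two_eq_zero_or_one (x / 2 ^ s) with h | h <;> simp [h]

lemma leafCount_succ (n : ℕ) (a : ℕ → ℕ) (j r : ℕ) :
    leafCount n a j (r + 1) = leafCount n a j r + (hasLeaf n a j (r + 1)).toNat := by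
  unfold leafCount
  rw [Finset.card_filter, Finset.card_filter, Finset.sum_Icc_succ_top (by omega)]
  cases hasLeaf n a j (r + 1) <;> simp

lemma leafCount_mono (n : ℕ) (a : ℕ → ℕ) (j : ℕ) : Monotone (leafCount n a j) :=
  monotone_nat_of_le_succ fun r => by rw [leafCount_succ]; omega

lemma leafCount_pred_lt {n : ℕ} {a : ℕ → ℕ} {j i r : ℕ} (hi : 1 ≤ i) (hir : i ≤ r)
    (hl : hasLeaf n a j i = true) : leafCount n a j (i - 1) < leafCount n a j r := by
  obtain ⟨i, rfl⟩ : ∃ i', i = i' + 1 := ⟨i - 1, by omega⟩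
  have h1 := leafCount_succ n a j i
  have h2 := leafCount_mono n a j hir
  rw [hl] at h1
  simp only [Bool.toNat_true, Nat.add_sub_cancel] at h1 ⊢
  omega

lemma h_eq_sum (n : ℕ) (a : ℕ → ℕ) (j : ℕ) :
    h n a j = ∑ i ∈ Finset.Icc 1 (n + 1), (hasLeaf n a j i).toNat := by
  unfold h leafCount
  rw [Finset.card_filter]
  refine Finset.sum_congr rfl fun i _ => ?_
  cases hasLeaf n a j i <;> simp

lemma h_eq_zero_of_depth_lt {n : ℕ} {a : ℕ → ℕ} {j : ℕ} (hj : depth n a < j) : h n a j = 0 := by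
  rw [h_eq_sum]
  refine Finset.sum_eq_zero fun i _ => ?_
  simp [hasLeaf, hj.not_ge]

lemma sum_side (n : ℕ) (a : ℕ → ℕ) :
    ∑ i ∈ Finset.Icc 1 (n + 1), side n a i = 2 ^ depth n a := by
  have hm : mass n a ≤ 2 ^ depth n a := Nat.le_pow_clog (by norm_num) _
  rw [Finset.sum_Icc_succ_top (by omega)]
  have : ∑ i ∈ Finset.Icc 1 n, side n a i = mass n a := by
    refine Finset.sum_congr rfl fun i hi => ?_
    have := (Finset.mem_Icc.1 hi).2
    simp [side, show i ≠ n + 1 by omega]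
  rw [this, side, if_pos rfl]
  omega

lemma bound_succ (n : ℕ) (a : ℕ → ℕ) (c : ℕ) :
    bound n a (c + 1) = 2 * bound n a c - h n a (c + 1) := by
  unfold bound
  rw [Finset.sum_range_succ _ (c + 1), mul_sub, Finset.mul_sum]
  have : ∑ j ∈ Finset.range (c + 1), (h n a j : ℤ) * 2 ^ (c + 1 - j) =
      ∑ j ∈ Finset.range (c + 1), 2 * ((h n a j : ℤ) * 2 ^ (c - j)) := by
    refine Finset.sum_congr rfl fun j hj => ?_
    have := Finset.mem_range.1 hj
    rw [show c + 1 - j = c - j + 1 by omega, pow_succ]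
    ring
  rw [this, pow_succ]
  simp
  ring

/-- The inner nodes of row `c` carry the mass that is not yet spent: scaled by `2 ^ (k - c)`, their
number is the sum of the low-order parts of the weights. -/
lemma two_pow_mul_bound (n : ℕ) (a : ℕ → ℕ) (c : ℕ) (hc : c ≤ depth n a) :
    2 ^ (depth n a - c) * bound n a c =
      ((∑ i ∈ Finset.Icc 1 (n + 1), side n a i % 2 ^ (depth n a - c) : ℕ) : ℤ) := by
  have key : ∀ s j : ℕ, s + j = depth n a →
      ∑ i ∈ Finset.Icc 1 (n + 1), side n a i % 2 ^ (s + 1) =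
        ∑ i ∈ Finset.Icc 1 (n + 1), side n a i % 2 ^ s + 2 ^ s * h n a j := by
    intro s j hsj
    rw [h_eq_sum, Finset.mul_sum, ← Finset.sum_add_distrib]
    refine Finset.sum_congr rfl fun i _ => ?_
    rw [mod_two_pow_succ]
    simp [hasLeaf, show j ≤ depth n a by omega, show depth n a - j = s by omega]
  induction c with
  | zero =>
    have h0 := key (depth n a) 0 rfl
    have h1 : ∑ i ∈ Finset.Icc 1 (n + 1), side n a i % 2 ^ (depth n a + 1) = 2 ^ depth n a := by
      rw [← sum_side]
      refine Finset.sum_congr rfl fun i hi => Nat.mod_eq_of_lt ?_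
      have h2 : side n a i ≤ 2 ^ depth n a := by
        rw [← sum_side]
        exact Finset.single_le_sum (f := side n a) (fun _ _ => Nat.zero_le _) hi
      have : 0 < 2 ^ depth n a := by positivity
      rw [pow_succ]
      omega
    rw [h1] at h0
    have h2 : (2 : ℤ) ^ depth n a =
        ((∑ i ∈ Finset.Icc 1 (n + 1), side n a i % 2 ^ depth n a : ℕ) : ℤ) +
          2 ^ depth n a * h n a 0 := by exact_mod_cast h0
    simp only [bound, Nat.sub_zero, zero_add, Finset.sum_range_one, pow_zero, mul_one]
    linarith
  | succ c ih =>
    have h0 := key (depth n a - (c + 1)) (c + 1) (by omega)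
    have h1 := ih (by omega)
    rw [show depth n a - c = depth n a - (c + 1) + 1 by omega, h0] at h1
    rw [bound_succ]
    push_cast at h1 ⊢
    rw [pow_succ] at h1
    linarith

lemma bound_eq_zero {n : ℕ} {a : ℕ → ℕ} {c : ℕ} (hc : depth n a ≤ c) : bound n a c = 0 := by
  induction c, hc using Nat.le_induction with
  | base => simpa [Nat.mod_one] using two_pow_mul_bound n a _ le_rfl
  | succ c hc ih => rw [bound_succ, ih, h_eq_zero_of_depth_lt (by omega)]; simp

lemma bound_nonneg (n : ℕ) (a : ℕ → ℕ) (c : ℕ) : 0 ≤ bound n a c := by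
  rcases le_total c (depth n a) with hc | hc
  · have h1 := two_pow_mul_bound n a c hc
    have h2 : (0 : ℤ) ≤ 2 ^ (depth n a - c) * bound n a c := by rw [h1]; positivity
    exact nonneg_of_mul_nonneg_right h2 (by positivity)
  · exact (bound_eq_zero hc).ge

/-- Each of the `n + 1` low-order parts is less than `2 ^ (k - c)`. -/
lemma bound_le (n : ℕ) (a : ℕ → ℕ) (c : ℕ) : bound n a c ≤ n := by
  rcases le_total c (depth n a) with hc | hc
  · have h1 := two_pow_mul_bound n a c hc
    have h2 : ∑ i ∈ Finset.Icc 1 (n + 1), side n a i % 2 ^ (depth n a - c) <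
        2 ^ (depth n a - c) * (n + 1) := by
      calc _ < ∑ i ∈ Finset.Icc 1 (n + 1), 2 ^ (depth n a - c) :=
            Finset.sum_lt_sum_of_nonempty ⟨1, by simp⟩
              fun i _ => Nat.mod_lt _ (by positivity)
        _ = _ := by simp [mul_comm]
    have h3 : (2 : ℤ) ^ (depth n a - c) * bound n a c < 2 ^ (depth n a - c) * (n + 1) := by
      rw [h1]; exact_mod_cast h2
    have := lt_of_mul_lt_mul_left h3 (by positivity)
    omega
  · rw [bound_eq_zero hc]; positivity

lemma lt_depth_of_bound_pos {n : ℕ} {a : ℕ → ℕ} {c : ℕ} (hc : 0 < bound n a c) :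
    c < depth n a := by
  by_contra hlt
  exact hc.ne' (bound_eq_zero (not_lt.1 hlt))

lemma bound_eq_zero_of_le {n : ℕ} {a : ℕ → ℕ} {j c : ℕ} (hj : bound n a j = 0) (hc : j ≤ c) :
    bound n a c = 0 := by
  induction c, hc using Nat.le_induction with
  | base => exact hj
  | succ c _ ih => have := bound_succ n a c; have := bound_nonneg n a (c + 1); omega

lemma h_eq_zero_of_bound_eq_zero {n : ℕ} {a : ℕ → ℕ} {j c : ℕ} (hj : bound n a j = 0)
    (hc : j < c) : h n a c = 0 := by
  obtain ⟨c, rfl⟩ : ∃ c', c = c' + 1 := ⟨c - 1, by omega⟩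
  have h1 := bound_succ n a c
  have h2 := bound_eq_zero_of_le hj (show j ≤ c by omega)
  have h3 := bound_eq_zero_of_le hj hc.le
  omega

lemma lastPos_eq (n : ℕ) (a : ℕ → ℕ) (c : ℕ) :
    lastPos n a c = bound n a c + h n a c - 1 := by
  cases c with
  | zero => simp [lastPos, bound]
  | succ c => rw [lastPos, bound_succ]; ring

lemma h_pos {n : ℕ} {a : ℕ → ℕ} {j i : ℕ} (hi : 1 ≤ i) (hin : i ≤ n + 1)
    (hl : hasLeaf n a j i = true) : 0 < h n a j :=
  (Nat.zero_le _).trans_lt (leafCount_pred_lt hi hin hl)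

/-! ### The entries of the matrix -/

/-- The position at which the label `i` stands in row `j` if that row has a leaf `i`. -/
def leafPos (n : ℕ) (a : ℕ → ℕ) (j i : ℕ) : ℤ := lastPos n a j - leafCount n a j (i - 1)

lemma rowAfter_eq_iff {n : ℕ} {a : ℕ → ℕ} {j i : ℕ} (hi : 1 ≤ i) (r : ℕ) (d : ℤ) :
    rowAfter n a j r d = i ↔ i ≤ r ∧ hasLeaf n a j i = true ∧ d = leafPos n a j i := by
  induction r with
  | zero => simp only [rowAfter]; omega
  | succ r ih =>
    rw [rowAfter]
    by_cases hl : hasLeaf n a j (r + 1) = true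
    · rw [if_pos hl, Function.update_apply]
      by_cases hd : d = lastPos n a j - leafCount n a j r
      · rw [if_pos hd]
        constructor
        · rintro rfl
          exact ⟨le_rfl, hl, by simpa [leafPos] using hd⟩
        · rintro ⟨h1, h2, h3⟩
          by_contra hne
          have := leafCount_pred_lt hi (show i ≤ r by omega) h2
          unfold leafPos at h3
          omega
      · rw [if_neg hd, ih]
        constructor
        · rintro ⟨h1, h2⟩
          exact ⟨by omega, h2⟩
        · rintro ⟨h1, h2, h3⟩
          refine ⟨?_, h2, h3⟩
          by_contra hne
          obtain rfl : i = r + 1 := by omega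
          exact hd (by simpa [leafPos] using h3)
    · rw [if_neg hl, ih]
      constructor
      · rintro ⟨h1, h2⟩
        exact ⟨by omega, h2⟩
      · rintro ⟨h1, h2, h3⟩
        refine ⟨?_, h2, h3⟩
        by_contra hne
        obtain rfl : i = r + 1 := by omega
        exact hl h2

lemma H_eq_iff {n : ℕ} {a : ℕ → ℕ} {c i : ℕ} (hi : 1 ≤ i) (hin : i ≤ n + 1) (d : ℤ) :
    H n a d c = i ↔ hasLeaf n a c i = true ∧ d = leafPos n a c i := by
  rw [H, rowAfter_eq_iff hi]
  exact ⟨fun h => h.2, fun h => ⟨hin, h⟩⟩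

/-- Leaves stand to the right of the inner nodes. -/
lemma bound_le_of_H_eq {n : ℕ} {a : ℕ → ℕ} {c i : ℕ} {d : ℤ} (hi : 1 ≤ i) (hin : i ≤ n + 1)
    (hd : H n a d c = i) : bound n a c ≤ d := by
  obtain ⟨hl, rfl⟩ := (H_eq_iff hi hin d).1 hd
  have h1 := leafCount_pred_lt hi hin hl
  have h2 := lastPos_eq n a c
  unfold leafPos
  unfold h at h2
  omega

/-- The largest label is written last, that is, directly next to the inner nodes. -/
lemma H_ne_extra {n : ℕ} {a : ℕ → ℕ} {c : ℕ} {d : ℤ} (hd : bound n a c + isThere n a c ≤ d) :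
    H n a d c ≠ n + 1 := by
  intro hH
  obtain ⟨hl, hp⟩ := (H_eq_iff (by omega) le_rfl d).1 hH
  have h1 := leafCount_succ n a c n
  have h2 := lastPos_eq n a c
  rw [hl, Bool.toNat_true] at h1
  rw [leafPos, Nat.add_sub_cancel] at hp
  unfold h at h2
  obtain rfl : d = bound n a c := by omega
  rw [isThere, if_pos hH] at hd
  omega

/-- If the root is a leaf, there is no inner node. -/
lemma bound_zero_of_H_root {n : ℕ} {a : ℕ → ℕ} {i : ℕ} (hi : 1 ≤ i) (hin : i ≤ n + 1)
    (hH : H n a 0 0 = i) : bound n a 0 = 0 :=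
  le_antisymm (bound_le_of_H_eq hi hin hH) (bound_nonneg n a 0)

/-! ### The probabilities of the labels -/

/-- The number of leaves `i` in row `j`, which is `0` or `1`, as a weight. -/
def leafInd (n : ℕ) (a : ℕ → ℕ) (j i : ℕ) : ℝ≥0∞ := if hasLeaf n a j i = true then 1 else 0

lemma probFrom_eq_tsum {n : ℕ} {a : ℕ → ℕ} {i : ℕ} (hi : 1 ≤ i) (hin : i ≤ n + 1) (j : ℕ) :
    probFrom n a i j = ∑' e : ℕ, leafInd n a (j + 1 + e) i * 2⁻¹ ^ (e + 1) := by
  have h1 : probFrom n a i j = ∑' q : ℤ × ℕ, Set.indicator {q | H n a q.1 q.2 = i ∧ j < q.2}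
      (fun q => (2⁻¹ : ℝ≥0∞) ^ (q.2 - j)) q :=
    tsum_subtype {q : ℤ × ℕ | H n a q.1 q.2 = i ∧ j < q.2} fun q => (2⁻¹ : ℝ≥0∞) ^ (q.2 - j)
  have hinj : Function.Injective fun e : ℕ => (leafPos n a (j + 1 + e) i, j + 1 + e) := by
    intro e e' he
    have := (Prod.ext_iff.1 he).2
    simpa using this
  rw [h1, ← hinj.tsum_eq]
  · refine tsum_congr fun e => ?_
    by_cases hl : hasLeaf n a (j + 1 + e) i = true
    · rw [Set.indicator_of_mem, leafInd, if_pos hl, one_mul]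
      · congr 1; simp only; omega
      · exact ⟨(H_eq_iff hi hin _).2 ⟨hl, rfl⟩, by simp only; omega⟩
    · rw [Set.indicator_of_notMem, leafInd, if_neg hl, zero_mul]
      exact fun hmem => hl ((H_eq_iff hi hin _).1 hmem.1).1
  · intro q hq
    obtain ⟨h2, h3⟩ := Set.mem_of_indicator_ne_zero hq
    have h4 := ((H_eq_iff hi hin _).1 h2).2
    refine ⟨q.2 - j - 1, ?_⟩
    have h5 : j + 1 + (q.2 - j - 1) = q.2 := by omega
    ext1
    · simp only [h5]; exact h4.symm
    · exact h5

/-- A step down halves the weight; the leaf `i` of the next row is either reached by it or not. -/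
lemma probFrom_succ {n : ℕ} {a : ℕ → ℕ} {i : ℕ} (hi : 1 ≤ i) (hin : i ≤ n + 1) (j : ℕ) :
    probFrom n a i j = 2⁻¹ * (leafInd n a (j + 1) i + probFrom n a i (j + 1)) := by
  rw [probFrom_eq_tsum hi hin, probFrom_eq_tsum hi hin, tsum_eq_zero_add' ENNReal.summable,
    mul_add, ← ENNReal.tsum_mul_left]
  congr 1
  · simp [mul_comm]
  · refine tsum_congr fun e => ?_
    rw [show j + 1 + (e + 1) = j + 1 + 1 + e by omega, pow_succ _ (e + 1)]
    ring

lemma probFrom_eq_zero {n : ℕ} {a : ℕ → ℕ} {i : ℕ} (hi : 1 ≤ i) (hin : i ≤ n + 1) {j : ℕ}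
    (hj : bound n a j = 0) : probFrom n a i j = 0 := by
  rw [probFrom_eq_tsum hi hin, ENNReal.tsum_eq_zero]
  intro e
  rw [leafInd, if_neg, zero_mul]
  intro hl
  exact (h_pos hi hin hl).ne' (h_eq_zero_of_bound_eq_zero hj (by omega))

lemma probFrom_zero_le (n : ℕ) (a : ℕ → ℕ) (i : ℕ) : probFrom n a i 0 ≤ prob n a i := by
  refine ENNReal.tsum_comp_le_tsum_of_injective
    (f := fun q : {q : ℤ × ℕ // H n a q.1 q.2 = i ∧ 0 < q.2} =>
      (⟨q.1, q.2.1⟩ : {q : ℤ × ℕ // H n a q.1 q.2 = i})) ?_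
    fun q : {q : ℤ × ℕ // H n a q.1 q.2 = i} => (2⁻¹ : ℝ≥0∞) ^ q.1.2
  intro q q' hq
  exact Subtype.ext (congrArg (fun q => q.1) hq)

lemma one_le_prob {n : ℕ} {a : ℕ → ℕ} {i : ℕ} (hH : H n a 0 0 = i) : 1 ≤ prob n a i := by
  have := ENNReal.le_tsum (f := fun q : {q : ℤ × ℕ // H n a q.1 q.2 = i} =>
    (2⁻¹ : ℝ≥0∞) ^ q.1.2) ⟨(0, 0), hH⟩
  simpa [prob] using this

/-- To draw `i` means to draw it at once, or to draw the additional label and to start again. -/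
lemma probRe_eq (n : ℕ) (a : ℕ → ℕ) (i : ℕ) :
    prob n a i + prob n a (n + 1) * probRe n a i = probRe n a i := by
  have h1 : ∑' j : ℕ, prob n a (n + 1) ^ (j + 1) =
      prob n a (n + 1) * (1 + ∑' j : ℕ, prob n a (n + 1) ^ (j + 1)) := by
    conv_lhs => rw [tsum_eq_zero_add' ENNReal.summable]
    rw [mul_add, ← ENNReal.tsum_mul_left]
    simp only [zero_add, pow_one, mul_one, ← pow_succ']
  unfold probRe
  conv_rhs => rw [h1]
  ring

lemma probReFrom_succ {n : ℕ} {a : ℕ → ℕ} {i : ℕ} (hi : 1 ≤ i) (hin : i ≤ n) (j : ℕ) :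
    probReFrom n a i j = 2⁻¹ * (leafInd n a (j + 1) i + leafInd n a (j + 1) (n + 1) * probRe n a i +
      probReFrom n a i (j + 1)) := by
  rw [probReFrom, probFrom_succ hi (by omega), probFrom_succ (i := n + 1) (by omega) le_rfl,
    probReFrom]
  ring

lemma probReFrom_eq_zero {n : ℕ} {a : ℕ → ℕ} {i : ℕ} (hi : 1 ≤ i) (hin : i ≤ n) {j : ℕ}
    (hj : bound n a j = 0) : probReFrom n a i j = 0 := by
  rw [probReFrom, probFrom_eq_zero hi (by omega) hj, probFrom_eq_zero (by omega) le_rfl hj]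
  simp

lemma probReFrom_zero_le (n : ℕ) (a : ℕ → ℕ) (i : ℕ) : probReFrom n a i 0 ≤ probRe n a i := by
  rw [← probRe_eq n a i]
  exact add_le_add (probFrom_zero_le n a i) (mul_le_mul_left (probFrom_zero_le n a (n + 1)) _)

end FLDR

/-! ### Expectations -/

/-- The expected value of `g` in `μ`. -/
noncomputable def expect {S : Type} (μ : Weight S) (g : S → ℝ≥0∞) : ℝ≥0∞ := ∑' s, μ s * g s

section expect

variable {S : Type}

lemma expect_add_left (μ ν : Weight S) (g : S → ℝ≥0∞) :
    expect (μ + ν) g = expect μ g + expect ν g := by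
  simp only [expect, Pi.add_apply, add_mul, ENNReal.tsum_add]

lemma expect_add_right (μ : Weight S) (f g : S → ℝ≥0∞) :
    expect μ (fun s => f s + g s) = expect μ f + expect μ g := by
  simp only [expect, mul_add, ENNReal.tsum_add]

lemma expect_one (μ : Weight S) : expect μ (fun _ => 1) = ∑' s, μ s := by
  simp [expect]

lemma expect_const_mul (p : ℝ≥0∞) (μ : Weight S) (g : S → ℝ≥0∞) :
    expect (fun s => p * μ s) g = expect μ (fun s => p * g s) :=
  tsum_congr fun s => by ring

lemma expect_diracDist (s : S) (g : S → ℝ≥0∞) : expect (diracDist s) g = g s := by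
  rw [expect, tsum_eq_single s]
  · simp [diracDist]
  · intro s' hs'
    simp [diracDist, hs']

open Classical in
lemma expect_ite_eq (μ : Weight S) (s : S) (r : ℝ≥0∞) :
    expect μ (fun s' => if s' = s then r else 0) = μ s * r := by
  rw [expect, tsum_eq_single s]
  · simp
  · intro s' hs'
    simp [hs']

open Classical in
lemma prSat_eq_expect (μ : Weight S) (B : S → Prop) :
    prSat μ B = expect μ (fun s => if B s then 1 else 0) := by
  refine (tsum_subtype {s | B s} μ).trans (tsum_congr fun s => ?_)
  by_cases hs : B s <;> simp [hs]

open Classical in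
lemma filtered_apply (B : S → Prop) (μ : Weight S) (s : S) :
    filtered B μ s = if B s then μ s else 0 := by
  by_cases hs : B s <;> simp [filtered, hs]

lemma filtered_add_filtered_not (B : S → Prop) (μ : Weight S) :
    filtered B μ + filtered (fun s => ¬ B s) μ = μ := by
  ext s
  by_cases hs : B s <;> simp [filtered_apply, hs]

lemma prSat_eq_one_iff {μ : Weight S} (hμ : μ ∈ dists S) (B : S → Prop) :
    prSat μ B = 1 ↔ ∀ s, μ s ≠ 0 → B s := by
  have h1 : prSat μ B = ∑' s, filtered B μ s := tsum_subtype {s | B s} μ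
  have h2 : ∑' s, filtered B μ s + ∑' s, filtered (fun s => ¬ B s) μ s = 1 := by
    rw [← ENNReal.tsum_add]
    refine Eq.trans (tsum_congr fun s => ?_) hμ
    exact congrFun (filtered_add_filtered_not B μ) s
  rw [h1]
  constructor
  · intro h3 s hs
    rw [h3] at h2
    have h4 : ∑' s, filtered (fun s => ¬ B s) μ s = 0 :=
      (ENNReal.add_right_inj ENNReal.one_ne_top).1 (h2.trans (add_zero 1).symm)
    have h5 := ENNReal.tsum_eq_zero.1 h4 s
    by_contra hB
    exact hs (by simpa [filtered_apply, hB] using h5)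
  · intro h3
    refine Eq.trans (tsum_congr fun s => ?_) hμ
    by_cases hs : μ s = 0
    · simp [filtered_apply, hs]
    · simp [filtered_apply, h3 s hs]

end expect

/-! ### The semantics of the loop body by duality -/

section den

variable {V : Type} [DecidableEq V]

lemma expect_assign (x : V) (E : PState V → ℤ) (μ : Weight (PState V)) (g : PState V → ℝ≥0∞) :
    expect ((Prog.assign x E).den μ) g = expect μ fun σ => g (Function.update σ x (E σ)) := by
  let f : PState V → PState V := fun σ => Function.update σ x (E σ)
  have h1 : expect ((Prog.assign x E).den μ) g =
      ∑' τ, ∑' σ : {σ // f σ = τ}, μ σ * g (f σ) := by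
    refine tsum_congr fun τ => ?_
    rw [Prog.den, ← ENNReal.tsum_mul_right]
    exact tsum_congr fun σ => by rw [show f σ = τ from σ.2]
  rw [h1, ← ENNReal.tsum_sigma' fun p : Σ τ, {σ // f σ = τ} => μ p.2 * g (f p.2)]
  exact (Equiv.sigmaFiberEquiv f).tsum_eq fun σ => μ σ * g (f σ)

lemma expect_choice (p : unitInterval) (C D : Prog V) (μ : Weight (PState V))
    (g : PState V → ℝ≥0∞) :
    expect ((Prog.choice p C D).den μ) g =
      expect (C.den fun σ => ENNReal.ofReal (p : ℝ) * μ σ) g +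
        expect (D.den fun σ => ENNReal.ofReal (1 - (p : ℝ)) * μ σ) g := by
  rw [Prog.den, expect_add_left]

lemma seq_den (C D : Prog V) (μ : Weight (PState V)) :
    (Prog.seq C D).den μ = D.den (C.den μ) := rfl

lemma ifThen_den (B : PState V → Prop) (C : Prog V) (μ : Weight (PState V)) :
    (Prog.ifThen B C).den μ = C.den (filtered B μ) + filtered (fun σ => ¬ B σ) μ := by
  rw [Prog.ifThen, Prog.den, Prog.den]

end den

namespace FLDR

@[simp] lemma state_d (x y z : ℤ) : state x y z .d = x := rfl
@[simp] lemma state_c (x y z : ℤ) : state x y z .c = y := rfl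
@[simp] lemma state_n (x y z : ℤ) : state x y z .n = z := rfl

lemma state_eta (σ : PState Var) : state (σ .d) (σ .c) (σ .n) = σ := by
  ext v; cases v <;> rfl

lemma state_inj {x y z x' y' z' : ℤ} :
    state x y z = state x' y' z' ↔ x = x' ∧ y = y' ∧ z = z' := by
  constructor
  · intro h
    exact ⟨congrFun h .d, congrFun h .c, congrFun h .n⟩
  · rintro ⟨rfl, rfl, rfl⟩
    rfl

/-- The end of the loop body: back to the root if the additional label has been drawn. -/
noncomputable def reset (a : ℕ → ℕ → ℕ) (σ : PState Var) : PState Var :=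
  if (H (σ .n).toNat (a (σ .n).toNat) (σ .d) (σ .c).toNat : ℤ) = σ .n + 1 then
    state 0 0 (σ .n) else σ

/-- The loop body when the coin shows `e`, which is `0` or `1`. -/
noncomputable def step (a : ℕ → ℕ → ℕ) (e : ℤ) (σ : PState Var) : PState Var :=
  reset a (state (2 * σ .d + e) (σ .c + 1) (σ .n))

lemma expect_body (a : ℕ → ℕ → ℕ) (μ : Weight (PState Var)) (g : PState Var → ℝ≥0∞) :
    expect ((body a).den μ) g =
      expect μ fun σ => 2⁻¹ * g (step a 0 σ) + 2⁻¹ * g (step a 1 σ) := by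
  have hreset : ∀ ν : Weight (PState Var),
      expect ((Prog.ifThen
        (fun σ => (H (σ .n).toNat (a (σ .n).toNat) (σ .d) (σ .c).toNat : ℤ) = σ .n + 1)
        (.seq (.assign .c fun _ => 0) (.assign .d fun _ => 0))).den ν) g =
      expect ν fun σ => g (reset a σ) := by
    intro ν
    rw [ifThen_den, expect_add_left, seq_den, expect_assign, expect_assign, expect, expect,
      ← ENNReal.tsum_add]
    refine tsum_congr fun σ => ?_
    by_cases hσ : (H (σ .n).toNat (a (σ .n).toNat) (σ .d) (σ .c).toNat : ℤ) = σ .n + 1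
    · have : Function.update (Function.update σ Var.c 0) Var.d 0 = state 0 0 (σ .n) := by
        ext v; cases v <;> simp
      simp [filtered_apply, hσ, reset, this]
    · simp [filtered_apply, hσ, reset]
  have hhalf : ENNReal.ofReal (half : ℝ) = 2⁻¹ := by
    change ENNReal.ofReal (1 / 2) = 2⁻¹
    rw [one_div, ENNReal.ofReal_inv_of_pos (by norm_num)]; simp
  have hhalf' : ENNReal.ofReal (1 - (half : ℝ)) = 2⁻¹ := by
    rw [← hhalf]; congr 1; norm_num [half]
  rw [body, seq_den, seq_den, hreset, expect_choice, expect_assign, expect_assign, hhalf, hhalf',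
    expect_const_mul, expect_const_mul, ← expect_add_right, expect_assign]
  refine tsum_congr fun σ => ?_
  have h0 : Function.update (Function.update σ Var.c (σ .c + 1)) Var.d (2 * σ .d) =
      state (2 * σ .d) (σ .c + 1) (σ .n) := by
    ext v; cases v <;> simp
  have h1 : Function.update (Function.update σ Var.c (σ .c + 1)) Var.d (2 * σ .d + 1) =
      state (2 * σ .d + 1) (σ .c + 1) (σ .n) := by
    ext v; cases v <;> simp
  simp [step, h0, h1]

/-- One guarded iteration of the loop. -/
noncomputable def iter (a : ℕ → ℕ → ℕ) (μ : Weight (PState Var)) : Weight (PState Var) :=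
  (body a).den (filtered (guard a) μ) + filtered (fun σ => ¬ guard a σ) μ

lemma expect_iter (a : ℕ → ℕ → ℕ) (μ : Weight (PState Var)) (g : PState Var → ℝ≥0∞) :
    expect (iter a μ) g =
      expect (filtered (guard a) μ) (fun σ => 2⁻¹ * g (step a 0 σ) + 2⁻¹ * g (step a 1 σ)) +
        expect (filtered (fun σ => ¬ guard a σ) μ) g := by
  rw [iter, expect_add_left, expect_body]

lemma iter_mem_dists (a : ℕ → ℕ → ℕ) {μ : Weight (PState Var)} (hμ : μ ∈ dists (PState Var)) :
    iter a μ ∈ dists (PState Var) := by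
  have h1 := expect_iter a μ fun _ => 1
  simp only [mul_one, ENNReal.inv_two_add_inv_two] at h1
  rw [← expect_add_left, filtered_add_filtered_not, expect_one, expect_one] at h1
  exact h1.trans hμ

open Classical in
lemma body_apply (a : ℕ → ℕ → ℕ) (μ : Weight (PState Var)) (τ : PState Var) :
    (body a).den μ τ =
      ∑' σ, μ σ * (2⁻¹ * (if step a 0 σ = τ then 1 else 0) +
        2⁻¹ * (if step a 1 σ = τ then 1 else 0)) := by
  have h1 := expect_ite_eq ((body a).den μ) τ 1
  rw [mul_one, expect_body] at h1
  exact h1.symm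

lemma exists_of_iter_ne_zero {a : ℕ → ℕ → ℕ} {μ : Weight (PState Var)} {τ : PState Var}
    (hτ : iter a μ τ ≠ 0) :
    μ τ ≠ 0 ∨ ∃ σ, μ σ ≠ 0 ∧ guard a σ ∧ (τ = step a 0 σ ∨ τ = step a 1 σ) := by
  classical
  by_contra! hcon
  refine hτ ?_
  rw [iter, Pi.add_apply, filtered_apply, hcon.1, ite_self, add_zero, body_apply,
    ENNReal.tsum_eq_zero]
  intro σ
  rw [filtered_apply]
  by_cases hg : guard a σ
  · by_cases hσ : μ σ = 0
    · simp [hσ]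
    · have := hcon.2 σ hσ hg
      simp [this.1.symm, this.2.symm]
  · simp [hg]

lemma guard_state (a : ℕ → ℕ → ℕ) (N j : ℕ) (x : ℤ) :
    guard a (state x j N) ↔ x < bound N (a N) j := by
  simp [guard]

lemma reset_state (a : ℕ → ℕ → ℕ) (N j : ℕ) (x : ℤ) :
    reset a (state x j N) = if H N (a N) x j = N + 1 then state 0 0 N else state x j N := by
  have : ((H N (a N) x j : ℤ) = N + 1) ↔ H N (a N) x j = N + 1 := by norm_cast
  simp [reset, this]

lemma step_state (a : ℕ → ℕ → ℕ) (N j : ℕ) (x e : ℤ) :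
    step a e (state x j N) = reset a (state (2 * x + e) ((j + 1 : ℕ) : ℤ) N) := by
  simp [step]

lemma reset_eq_of_c_ne_zero {a : ℕ → ℕ → ℕ} {σ τ : PState Var} (hσ : reset a σ = τ)
    (hτ : τ .c ≠ 0) : σ = τ := by
  unfold reset at hσ
  split_ifs at hσ
  · exact absurd (by rw [← hσ]; rfl) hτ
  · exact hσ

/-! ### The rows of a uniform distribution -/

/-- The part of the invariant that does not speak of the outputs: the support, and uniformity on
the inner nodes of a row. -/
structure UniformRows (N : ℕ) (a : ℕ → ℕ) (μ : Weight (PState Var)) : Prop where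
  support : ∀ σ, μ σ ≠ 0 →
    σ .n = N ∧ (0 ≤ σ .d ∧ σ .d ≤ 2 * N - 1) ∧ (0 ≤ σ .c ∧ σ .c ≤ depth N a)
  inner : ∀ x j : ℕ, (x : ℤ) < bound N a j → μ (state x j N) = μ (state 0 j N)

lemma Conditions.uniformRows {N : ℕ} {a : ℕ → ℕ} {μ : Weight (PState Var)}
    (hμ : μ ∈ dists (PState Var)) (hc : Conditions N a μ) : UniformRows N a μ where
  support σ hσ := ⟨(prSat_eq_one_iff hμ _).1 hc.n_fixed σ hσ,
    (prSat_eq_one_iff hμ _).1 hc.d_bounds σ hσ, (prSat_eq_one_iff hμ _).1 hc.c_bounds σ hσ⟩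
  inner x j hx := by
    refine hc.inner_uniform _ _ ?_ ?_ rfl <;> simp <;> omega

section UniformRows

variable {N : ℕ} {a : ℕ → ℕ → ℕ} {μ : Weight (PState Var)}

lemma UniformRows.exists_eq_state (hμ : UniformRows N (a N) μ) {σ : PState Var} (hσ : μ σ ≠ 0)
    (hg : guard a σ) : ∃ x j : ℕ, (x : ℤ) < bound N (a N) j ∧ σ = state x j N := by
  obtain ⟨hn, ⟨hd, -⟩, hc, -⟩ := hμ.support σ hσ
  obtain ⟨x, hx⟩ := Int.eq_ofNat_of_zero_le hd
  obtain ⟨j, hj⟩ := Int.eq_ofNat_of_zero_le hc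
  have h1 : σ = state x j N := by
    rw [← state_eta σ, hn, hx, hj]
  exact ⟨x, j, by rwa [h1, guard_state] at hg, h1⟩

/-- The expected value over the inner nodes, row by row. -/
lemma UniformRows.expect_guard (hμ : UniformRows N (a N) μ) (F : PState Var → ℝ≥0∞) :
    expect (filtered (guard a) μ) F = ∑' j : ℕ, μ (state 0 j N) *
      ∑ x ∈ Finset.range (bound N (a N) j).toNat, F (state x j N) := by
  classical
  have hinj : Function.Injective fun q : ℕ × ℕ => state q.2 q.1 N := by
    rintro ⟨j, x⟩ ⟨j', x'⟩ hq
    have := state_inj.1 hq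
    exact Prod.ext (by exact_mod_cast this.2.1) (by exact_mod_cast this.1)
  rw [expect, ← hinj.tsum_eq]
  · rw [ENNReal.tsum_prod (f := fun j x : ℕ =>
      filtered (guard a) μ (state x j N) * F (state x j N))]
    refine tsum_congr fun j => ?_
    rw [Finset.mul_sum, tsum_eq_sum (s := Finset.range (bound N (a N) j).toNat)]
    · refine Finset.sum_congr rfl fun x hx => ?_
      have hx : (x : ℤ) < bound N (a N) j := by have := Finset.mem_range.1 hx; omega
      rw [filtered_apply, if_pos ((guard_state a N j x).2 hx), hμ.inner x j hx]
    · intro x hx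
      rw [filtered_apply, if_neg, zero_mul]
      rw [guard_state]
      have := mt Finset.mem_range.2 hx
      omega
  · intro σ hσ
    have h1 : filtered (guard a) μ σ ≠ 0 := left_ne_zero_of_mul hσ
    rw [filtered_apply] at h1
    by_cases hg : guard a σ
    · rw [if_pos hg] at h1
      obtain ⟨x, j, -, rfl⟩ := hμ.exists_eq_state h1 hg
      exact ⟨(j, x), rfl⟩
    · simp [hg] at h1

/-- A node of row `j + 1` other than the leaf `N + 1` receives half the weight of its parent. -/
lemma UniformRows.body_apply_state (hμ : UniformRows N (a N) μ) {j : ℕ} {x : ℤ} (hx0 : 0 ≤ x)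
    (hx : x < 2 * bound N (a N) j) (hH : H N (a N) x (j + 1) ≠ N + 1) :
    (body a).den (filtered (guard a) μ) (state x (j + 1 : ℕ) N) = 2⁻¹ * μ (state 0 j N) := by
  classical
  obtain ⟨y, hy⟩ := Int.eq_ofNat_of_zero_le (show 0 ≤ x / 2 by omega)
  have hyb : (y : ℤ) < bound N (a N) j := by omega
  have hstep : ∀ e σ, step a e σ = state x (j + 1 : ℕ) N → σ = state ((x - e) / 2) j N ∧
      2 * σ .d + e = x := by
    intro e σ he
    have h1 := reset_eq_of_c_ne_zero he (by simp only [state_c]; omega)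
    rw [state_inj] at h1
    push_cast at h1
    refine ⟨?_, h1.1⟩
    rw [← state_eta σ, state_inj]
    omega
  rw [body_apply, tsum_eq_single (state y j N)]
  · rw [filtered_apply, if_pos ((guard_state a N j y).2 hyb), hμ.inner y j hyb, mul_comm]
    congr 1
    rcases Int.emod_two_eq_zero_or_one x with h2 | h2
    · rw [if_pos, if_neg]
      · simp
      · intro h1
        have := (hstep 1 _ h1).2
        rw [state_d] at this
        omega
      · rw [step_state, show 2 * (y : ℤ) + 0 = x by omega, reset_state, if_neg hH]
    · rw [if_neg, if_pos]
      · simp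
      · rw [step_state, show 2 * (y : ℤ) + 1 = x by omega, reset_state, if_neg hH]
      · intro h1
        have := (hstep 0 _ h1).2
        rw [state_d] at this
        omega
  · intro σ hσ
    have hne : ∀ e : ℤ, (e = 0 ∨ e = 1) → step a e σ ≠ state x (j + 1 : ℕ) N := by
      intro e he h1
      obtain ⟨h2, h3⟩ := hstep e σ h1
      refine hσ (h2.trans ?_)
      rw [h2, state_d] at h3
      rw [state_inj]
      omega
    rw [if_neg (hne 0 (by simp)), if_neg (hne 1 (by simp))]
    simp

lemma UniformRows.iter_support (hμ : UniformRows N (a N) μ) (hN : 0 < N) (τ : PState Var)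
    (hτ : iter a μ τ ≠ 0) :
    τ .n = N ∧ (0 ≤ τ .d ∧ τ .d ≤ 2 * N - 1) ∧ (0 ≤ τ .c ∧ τ .c ≤ depth N (a N)) := by
  rcases exists_of_iter_ne_zero hτ with h1 | ⟨σ, h1, hg, h2⟩
  · exact hμ.support τ h1
  · obtain ⟨x, j, hx, rfl⟩ := hμ.exists_eq_state h1 hg
    have h3 := bound_le N (a N) j
    have h4 := lt_depth_of_bound_pos (show 0 < bound N (a N) j by omega)
    rcases h2 with rfl | rfl <;>
    · rw [step_state, reset_state]
      split_ifs <;> simp <;> omega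

/-- After an iteration, two nodes of the same row other than the leaf `N + 1` have the same weight
if the terminated runs give them the same weight: the running ones contribute half the weight of an
inner node of the row above to either. In row `0` there is only one node. -/
lemma UniformRows.iter_eq (hμ : UniformRows N (a N) μ) (hN : 0 < N) {σ σ' : PState Var}
    (hn : σ .n = N) (hn' : σ' .n = N) (hcc : σ .c = σ' .c) (hd : 0 ≤ σ .d) (hd' : 0 ≤ σ' .d)
    (hlt : σ .d ≤ lastPos N (a N) (σ .c).toNat) (hlt' : σ' .d ≤ lastPos N (a N) (σ .c).toNat)
    (hH : σ .c ≠ 0 → H N (a N) (σ .d) (σ .c).toNat ≠ N + 1)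
    (hH' : σ .c ≠ 0 → H N (a N) (σ' .d) (σ .c).toNat ≠ N + 1)
    (hf : filtered (fun σ => ¬ guard a σ) μ σ = filtered (fun σ => ¬ guard a σ) μ σ') :
    iter a μ σ = iter a μ σ' := by
  rcases lt_trichotomy (σ .c) 0 with hc | hc | hc
  · have h0 : ∀ τ : PState Var, τ .c < 0 → iter a μ τ = 0 := by
      intro τ hτ
      by_contra hne
      have := (hμ.iter_support hN τ hne).2.2
      omega
    rw [h0 σ hc, h0 σ' (by omega)]
  · rw [hc, Int.toNat_zero, lastPos] at hlt hlt'
    congr 1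
    rw [← state_eta σ, ← state_eta σ', state_inj]
    omega
  · obtain ⟨j, hj⟩ := Int.eq_ofNat_of_zero_le (show 0 ≤ σ .c - 1 by omega)
    have hj : σ .c = (j + 1 : ℕ) := by push_cast; omega
    have hs : σ = state (σ .d) (j + 1 : ℕ) N := by rw [← hj, ← hn, state_eta]
    have hs' : σ' = state (σ' .d) (j + 1 : ℕ) N := by rw [← hj, hcc, ← hn', state_eta]
    rw [hj, Int.toNat_natCast, lastPos] at hlt hlt'
    have hH := hH hc.ne'
    have hH' := hH' hc.ne'
    rw [hj, Int.toNat_natCast] at hH hH'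
    rw [iter, Pi.add_apply, Pi.add_apply, hf]
    congr 1
    rw [hs, hs', hμ.body_apply_state hd (by omega) hH, hμ.body_apply_state hd' (by omega) hH']

end UniformRows

/-! ### The potential of the output condition -/

open Classical in
/-- The left-hand side of the output condition as the expected value of a function of the state:
`1` for the leaves `i`, and at position `0` of row `j` the weight of `i` below row `j`, which is `0`
unless that position is an inner node. -/
noncomputable def potential (N : ℕ) (a : ℕ → ℕ) (i : ℕ) (σ : PState Var) : ℝ≥0∞ :=
  (if H N a (σ .d) (σ .c).toNat = i then 1 else 0) +
    ∑ j ∈ Finset.range (depth N a), if σ = state 0 j N then probReFrom N a i j else 0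

lemma expect_potential (N : ℕ) (a : ℕ → ℕ) (i : ℕ) (μ : Weight (PState Var)) :
    expect μ (potential N a i) = prSat μ (fun σ => H N a (σ .d) (σ .c).toNat = i) +
      ∑ j ∈ Finset.range (depth N a), μ (state 0 j N) * probReFrom N a i j := by
  classical
  unfold potential
  rw [expect_add_right, prSat_eq_expect]
  congr 1
  · refine tsum_congr fun σ => ?_
    dsimp only
    congr
  · simp only [← expect_ite_eq]
    unfold expect
    simp only [Finset.mul_sum]
    rw [Summable.tsum_finsetSum fun _ _ => ENNReal.summable]

lemma potential_state (N : ℕ) (a : ℕ → ℕ) (i : ℕ) (x : ℤ) (c : ℕ) :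
    potential N a i (state x c N) = (if H N a x c = i then 1 else 0) +
      if x = 0 ∧ c < depth N a then probReFrom N a i c else 0 := by
  classical
  unfold potential
  congr 1
  by_cases hx : x = 0
  · simp [state_inj, hx]
  · simp [state_inj, hx]

lemma potential_state_le (N : ℕ) (a : ℕ → ℕ) (i : ℕ) (x : ℤ) (c : ℕ) :
    potential N a i (state x c N) ≤ (if H N a x c = i then 1 else 0) +
      if x = 0 then probReFrom N a i c else 0 := by
  rw [potential_state]
  gcongr
  split_ifs with h1 h2
  · exact le_rfl
  · exact absurd h1.1 h2
  · exact zero_le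
  · exact le_rfl

variable {N : ℕ} {i : ℕ}

lemma potential_root_le {a : ℕ → ℕ} (hi : 1 ≤ i) (hin : i ≤ N) :
    potential N a i (state 0 0 N) ≤ probRe N a i := by
  have h1 := potential_state_le N a i 0 0
  rw [Nat.cast_zero, if_pos rfl] at h1
  refine h1.trans ?_
  split_ifs with hH
  · rw [probReFrom_eq_zero hi hin (bound_zero_of_H_root hi (by omega) hH), add_zero,
      ← probRe_eq]
    exact (one_le_prob hH).trans le_self_add
  · rw [zero_add]
    exact probReFrom_zero_le N a i

lemma sum_range_ite_H_le {a : ℕ → ℕ} (hi : 1 ≤ i) (hin : i ≤ N + 1) (c m : ℕ) (w : ℝ≥0∞) :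
    ∑ y ∈ Finset.range m, (if H N a y c = i then w else 0) ≤ leafInd N a c i * w := by
  by_cases hl : hasLeaf N a c i = true
  · rw [leafInd, if_pos hl, one_mul]
    by_cases hp : 0 ≤ leafPos N a c i
    · obtain ⟨p, hp⟩ := Int.eq_ofNat_of_zero_le hp
      have h1 : ∀ y : ℕ, H N a y c = i ↔ p = y := by
        intro y
        rw [H_eq_iff hi hin, hp]
        simp only [hl, true_and]
        omega
      simp only [h1, Finset.sum_ite_eq]
      split_ifs
      · exact le_rfl
      · exact zero_le
    · rw [Finset.sum_eq_zero]
      · exact zero_le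
      · intro y _
        rw [if_neg]
        intro hH
        have := ((H_eq_iff hi hin _).1 hH).2
        omega
  · rw [Finset.sum_eq_zero]
    · exact zero_le
    · intro y _
      rw [if_neg]
      exact fun hH => hl ((H_eq_iff hi hin _).1 hH).1

lemma sum_range_pairs (G : ℕ → ℝ≥0∞) (m : ℕ) :
    ∑ x ∈ Finset.range m, (2⁻¹ * G (2 * x) + 2⁻¹ * G (2 * x + 1)) =
      2⁻¹ * ∑ y ∈ Finset.range (2 * m), G y := by
  induction m with
  | zero => simp
  | succ m ih =>
    rw [Finset.sum_range_succ, ih, show 2 * (m + 1) = 2 * m + 1 + 1 by ring,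
      Finset.sum_range_succ _ (2 * m + 1), Finset.sum_range_succ _ (2 * m)]
    ring

/-- If a distribution is uniform on the inner nodes of a row, an iteration does not increase the expected
potential: the children of these nodes together contribute the leaf `i` of the next row, the
re-roll at its leaf `N + 1` and the potential of its node `0`, which add up, halved, to the
potential of the node `0` of the row. -/
lemma sum_potential_step_le {a : ℕ → ℕ → ℕ} (hi : 1 ≤ i) (hin : i ≤ N) (j : ℕ) :
    ∑ x ∈ Finset.range (bound N (a N) j).toNat,
        (2⁻¹ * potential N (a N) i (step a 0 (state x j N)) +
          2⁻¹ * potential N (a N) i (step a 1 (state x j N))) ≤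
      ∑ x ∈ Finset.range (bound N (a N) j).toNat, potential N (a N) i (state x j N) := by
  rcases Nat.eq_zero_or_pos (bound N (a N) j).toNat with hb | hb
  · simp [hb]
  have hjk := lt_depth_of_bound_pos (show 0 < bound N (a N) j by omega)
  set m := (bound N (a N) j).toNat
  have hG : ∀ y : ℕ, potential N (a N) i (reset a (state y (j + 1 : ℕ) N)) ≤
      (if H N (a N) y (j + 1) = i then 1 else 0) +
        (if H N (a N) y (j + 1) = N + 1 then probRe N (a N) i else 0) +
          if 0 = y then probReFrom N (a N) i (j + 1) else 0 := by
    intro y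
    rw [reset_state]
    by_cases hH : H N (a N) y (j + 1) = N + 1
    · rw [if_pos hH, if_pos hH]
      exact (potential_root_le hi hin).trans (le_add_self.trans le_self_add)
    · rw [if_neg hH, if_neg hH, add_zero]
      refine (potential_state_le N (a N) i y (j + 1)).trans_eq ?_
      simp only [Nat.cast_eq_zero, eq_comm]
  calc ∑ x ∈ Finset.range m, (2⁻¹ * potential N (a N) i (step a 0 (state x j N)) +
          2⁻¹ * potential N (a N) i (step a 1 (state x j N)))
      = 2⁻¹ * ∑ y ∈ Finset.range (2 * m),
          potential N (a N) i (reset a (state y (j + 1 : ℕ) N)) := by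
        rw [← sum_range_pairs]
        refine Finset.sum_congr rfl fun x _ => ?_
        rw [step_state, step_state]
        push_cast
        rw [add_zero]
    _ ≤ 2⁻¹ * ∑ y ∈ Finset.range (2 * m), ((if H N (a N) y (j + 1) = i then 1 else 0) +
        (if H N (a N) y (j + 1) = N + 1 then probRe N (a N) i else 0) +
          if 0 = y then probReFrom N (a N) i (j + 1) else 0) := by
        gcongr with y _
        exact hG y
    _ ≤ 2⁻¹ * (leafInd N (a N) (j + 1) i * 1 + leafInd N (a N) (j + 1) (N + 1) * probRe N (a N) i +
          probReFrom N (a N) i (j + 1)) := by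
        rw [Finset.sum_add_distrib, Finset.sum_add_distrib]
        gcongr
        · exact sum_range_ite_H_le hi (by omega) _ _ _
        · exact sum_range_ite_H_le (by omega) le_rfl _ _ _
        · rw [Finset.sum_ite_eq, if_pos (Finset.mem_range.2 (by omega))]
    _ = probReFrom N (a N) i j := by rw [mul_one, ← probReFrom_succ hi hin]
    _ ≤ potential N (a N) i (state (0 : ℕ) j N) := by
        rw [potential_state, if_pos (⟨Nat.cast_zero, hjk⟩ : ((0 : ℕ) : ℤ) = 0 ∧ _)]
        exact le_add_self
    _ ≤ _ := Finset.single_le_sum (f := fun x : ℕ => potential N (a N) i (state x j N))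
        (fun _ _ => zero_le) (Finset.mem_range.2 hb)

/-! ### The invariant is inductive -/

lemma conditions_iter {a : ℕ → ℕ → ℕ} {μ : Weight (PState Var)} (hμ : μ ∈ dists (PState Var))
    (hN : 0 < N) (hc : Conditions N (a N) μ) : Conditions N (a N) (iter a μ) := by
  have hu := hc.uniformRows hμ
  have hd := iter_mem_dists a hμ
  have hs := hu.iter_support hN
  refine ⟨(prSat_eq_one_iff hd _).2 fun σ hσ => (hs σ hσ).1,
    (prSat_eq_one_iff hd _).2 fun σ hσ => (hs σ hσ).2.1,
    (prSat_eq_one_iff hd _).2 fun σ hσ => (hs σ hσ).2.2, ?_, ?_, ?_⟩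
  · intro i hi hin
    rw [← expect_potential]
    refine le_trans ?_ ((expect_potential N (a N) i μ).trans_le (hc.output_le i hi hin))
    conv_rhs => rw [← filtered_add_filtered_not (guard a) μ]
    rw [expect_iter, expect_add_left, hu.expect_guard, hu.expect_guard]
    refine add_le_add_left (ENNReal.tsum_le_tsum fun j => mul_le_mul_right ?_ _) _
    exact sum_potential_step_le hi hin j
  · rintro σ σ' ⟨hn, hd0, hd1⟩ ⟨hn', hd0', hd1'⟩ hcc
    rw [← hcc] at hd1'
    have hl := lastPos_eq N (a N) (σ .c).toNat
    have hg : guard a σ := by rw [guard, hn, Int.toNat_natCast]; omega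
    have hg' : guard a σ' := by rw [guard, hn', Int.toNat_natCast, ← hcc]; omega
    have hH : ∀ d : ℤ, d ≤ bound N (a N) (σ .c).toNat - 1 →
        H N (a N) d (σ .c).toNat ≠ N + 1 := by
      intro d hd hH
      have := bound_le_of_H_eq (by omega) le_rfl hH
      omega
    refine hu.iter_eq hN hn hn' hcc hd0 hd0' (by omega) (by omega) (fun _ => hH _ hd1)
      (fun _ => hH _ hd1') ?_
    simp [filtered_apply, hg, hg']
  · rintro σ σ' ⟨hn, hd0, hd1⟩ ⟨hn', hd0', hd1'⟩ hcc
    have hμeq := hc.leaf_uniform σ σ' ⟨hn, hd0, hd1⟩ ⟨hn', hd0', hd1'⟩ hcc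
    rw [← hcc] at hd0' hd1'
    have hl := lastPos_eq N (a N) (σ .c).toNat
    have hb := bound_nonneg N (a N) (σ .c).toNat
    have ht : 0 ≤ isThere N (a N) (σ .c).toNat := by unfold isThere; split_ifs <;> simp
    have hg : ¬ guard a σ := by rw [guard, hn, Int.toNat_natCast]; omega
    have hg' : ¬ guard a σ' := by rw [guard, hn', Int.toNat_natCast, ← hcc]; omega
    refine hu.iter_eq hN hn hn' hcc (by omega) (by omega) (by omega) (by omega)
      (fun _ => H_ne_extra hd0) (fun _ => H_ne_extra hd0') ?_
    simp [filtered_apply, hg, hg', hμeq]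

lemma iter_mem_invariant {a : ℕ → ℕ → ℕ} {μ : Weight (PState Var)} (hμ : μ ∈ invariant a) :
    iter a μ ∈ invariant a := by
  obtain ⟨hd, N, hN, hc⟩ := hμ
  exact ⟨iter_mem_dists a hd, N, hN, conditions_iter hd hN hc⟩

lemma diracDist_mem_dists {S : Type} (s : S) : diracDist s ∈ dists S := by
  have h1 := expect_diracDist s fun _ => 1
  rwa [expect_one] at h1

lemma initial_subset_invariant (a : ℕ → ℕ → ℕ) : initial ⊆ invariant a := by
  rintro _ ⟨N, hN, rfl⟩
  have hd := diracDist_mem_dists (state 0 0 N)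
  have hs : ∀ σ, diracDist (state 0 0 N) σ ≠ 0 → σ = state 0 0 N := by
    intro σ hσ
    by_contra hne
    exact hσ (by simp [diracDist, hne])
  -- The root is the only node of row `0`, so the uniformity conditions are void.
  have hu : ∀ σ σ' : PState Var, σ .n = N → σ' .n = N → σ .c = σ' .c → 0 ≤ σ .d → 0 ≤ σ' .d →
      σ .d ≤ lastPos N (a N) (σ .c).toNat → σ' .d ≤ lastPos N (a N) (σ .c).toNat →
      diracDist (state 0 0 N) σ = diracDist (state 0 0 N) σ' := by
    intro σ σ' hn hn' hcc hd hd' hlt hlt'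
    by_cases hc : σ .c = 0
    · rw [hc, Int.toNat_zero, lastPos] at hlt hlt'
      congr 1
      rw [← state_eta σ, ← state_eta σ', state_inj]
      omega
    · have h0 : ∀ τ : PState Var, τ .c ≠ 0 → diracDist (state 0 0 N) τ = 0 := by
        intro τ hτ
        by_contra hne
        rw [hs τ hne] at hτ
        exact hτ rfl
      rw [h0 σ hc, h0 σ' (by omega)]
  refine ⟨hd, N, hN, (prSat_eq_one_iff hd _).2 ?_, (prSat_eq_one_iff hd _).2 ?_,
    (prSat_eq_one_iff hd _).2 ?_, ?_, ?_, ?_⟩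
  · intro σ hσ; rw [hs σ hσ]; rfl
  · intro σ hσ; rw [hs σ hσ, state_d]; omega
  · intro σ hσ; rw [hs σ hσ, state_c]; omega
  · intro i hi hin
    rw [← expect_potential, expect_diracDist]
    exact potential_root_le hi hin
  · rintro σ σ' ⟨hn, hd0, hd1⟩ ⟨hn', hd0', hd1'⟩ hcc
    have hl := lastPos_eq N (a N) (σ .c).toNat
    rw [← hcc] at hd1'
    exact hu σ σ' hn hn' hcc hd0 hd0' (by omega) (by omega)
  · rintro σ σ' ⟨hn, hd0, hd1⟩ ⟨hn', hd0', hd1'⟩ hcc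
    have hl := lastPos_eq N (a N) (σ .c).toNat
    have hb := bound_nonneg N (a N) (σ .c).toNat
    have ht : 0 ≤ isThere N (a N) (σ .c).toNat := by unfold isThere; split_ifs <;> simp
    rw [← hcc] at hd0' hd1'
    exact hu σ σ' hn hn' hcc (by omega) (by omega) (by omega) (by omega)

end FLDR

theorem mainTheorem8 (a : ℕ → ℕ → ℕ) (ha : ∀ N i : ℕ, 1 ≤ i → i ≤ N → 0 < a N i) :
    IsDistInvariant (FLDR.prog a) FLDR.initial (FLDR.invariant a) ∧
      IsInductive (FLDR.prog a) (FLDR.invariant a) := by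
  refine ⟨⟨FLDR.guard a, FLDR.body a, rfl, ?_, fun μ hμ => hμ.1.le, ?_⟩,
    FLDR.guard a, FLDR.body a, rfl, fun μ hμ => FLDR.iter_mem_invariant hμ⟩
  · rintro _ ⟨N, -, rfl⟩
    exact (FLDR.diracDist_mem_dists _).le
  · refine OrderHom.lfp_le _ (Set.union_subset (FLDR.initial_subset_invariant a) ?_)
    rintro _ ⟨μ, hμ, rfl⟩
    rw [ifThen_den]
    exact FLDR.iter_mem_invariant hμ
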